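/- **Setting.** Let $G$ be a finite abelian group with the chain $1<G$, and fix an isomorphism $\varphi\colon G\to\hat G=\operatorname{Hom}(G,\mathbb C^\times)$. For $g\in G$ let $T_g=\mathbb C t_g$ be the one-dimensional representation with character $\varphi(g)$. For a nonempty subset $A\subseteq G$ let $\chi_A$ be the generalized character of the irreducible glider representation $\bigoplus_{g\in A}T_g\supset\mathbb C\sum_{g\in A}t_g\supset 0\supset\cdots$, and let $\chi_\emptyset$ be that of $\mathbb C\supset 0\supset\cdots$. The generalized character ring $R(\tilde G)$ is the free abelian group on the $\chi_A$, $A\subseteq G$, with the product induced by the tensor product of gliders ($(M\otimes M')_i=M_i\otimes M'_i$, decomposed into irreducible gliders); explicitly $\chi_A\chi_B=\chi_{AB}+(|A||B|-|AB|)\chi_\emptyset$ and $\chi_A\chi_\emptyset=|A|\chi_\emptyset$ for nonempty $A,B$, and $\chi_\emptyset^2=\chi_\emptyset$. Put $\mathbb Q(\tilde G)=\mathbb Q\otimes_{\mathbb Z}\bigl(R(\tilde G)/(\chi_\emptyset)\bigr)$ and let $\mathbb Q(\tilde G)_\theta=\mathbb Q(\tilde G)/(\chi_G)$ be the contracted algebra;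 images of $\chi_A$ are again denoted $\chi_A$. For nonempty $A\subseteq G$ let $n(A)$ be the unique minimal idempotent of the cyclic semigroup $\{A,A^2,A^3,\dots\}$; it is a subgroup $H$ of $G$, and $A$ lies in a single coset $gH$. In either algebra let $I$ be the ideal generated by all elements $\chi_{gH}-\chi_A$ with $A\neq\emptyset$, $H=n(A)$ and $A\subseteq gH$. For a proper subgroup $H$ of $G$ put $$\psi_H=\prod_{H'}(\chi_H-\chi_{H'}),$$ the product being over all subgroups $H'\supseteq H$ such that $H'/H$ is a minimal nontrivial subgroup of $G/H$. For a subgroup $H$ let $e_H$ be the unit element of the group algebra $\mathbb Q(G/H)$, and let $e_{gH}$ be its basis element belonging to $gH$. **Theorem.** 1. The Jacobson radical $J$ of $\mathbb Q(\tilde G)_\theta$ equals $I$, and there is a ring isomorphism $$\bigoplus_{H\lneq G}\mathbb Q(G/H)\;\longrightarrow\;\mathbb Q(\tilde G)_\theta/J$$ which sends $e_H$ to the class of $\psi_H$, and $e_{gH}$ to the class of $\chi_{\{g\}}\psi_H$ for $g\in G$. 2. The Jacobson radical $J$ of $\mathbb Q(\tilde G)$ equals $I$, and there is a ring isomorphism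 $$\bigoplus_{H\leq G}\mathbb Q(G/H)\;\longrightarrow\;\mathbb Q(\tilde G)/J$$ which sends $e_H$ to the class of $\psi_H$ for $H\neq G$, sends $e_G$ to the class of $\chi_G$, and sends $e_{gH}$ to the class of $\chi_{\{g\}}$ times the image of $e_H$ for all $H\leq G$, $g\in G$. -/

import Mathlib

open scoped Pointwise TensorProduct

noncomputable section

namespace GliderRing

/-! ### Glider representations -/

/-- A glider representation with respect to the filtration of `ℂ[G]` given by a chain `F` of
subgroups, inside the `ℂ[G]`-module `Ω` with action `ρ`: a descending chain
`Ω ⊇ M₀ ⊇ M₁ ⊇ ⋯` of subspaces with `ℂ[F i] Mⱼ ⊆ M_{j-i}` for `i ≤ j`.  (The additional inclusion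
`ℂ[F i] Mⱼ ⊆ {m ∈ M₀ | ℂ[F i] m ⊆ M₀}` is automatic, `F i` being closed under products.) -/
structure Glider {G Ω : Type*} [Group G] [AddCommGroup Ω] [Module ℂ Ω] (F : ℕ → Subgroup G)
    (ρ : Representation ℂ G Ω) where
  space : ℕ → Submodule ℂ Ω
  anti : Antitone space
  act_mem : ∀ i j : ℕ, i ≤ j → ∀ g ∈ F i, ∀ m ∈ space j, ρ g m ∈ space (j - i)

/-- The chain `1 < G`, that is `F 0 = 1` and `F i = G` for `i ≥ 1`. -/
def shortChain (G : Type*) [Group G] : ℕ → Subgroup G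
  | 0 => ⊥
  | _ + 1 => ⊤

/-- The tensor product of two gliders: `(M ⊗ M')ᵢ = Mᵢ ⊗ M'ᵢ` inside `Ω ⊗ Ω'`. -/
def Glider.tensor {G Ω Ω' : Type*} [Group G] [AddCommGroup Ω] [Module ℂ Ω] [AddCommGroup Ω']
    [Module ℂ Ω'] {F : ℕ → Subgroup G} {ρ : Representation ℂ G Ω} {ρ' : Representation ℂ G Ω'}
    (M : Glider F ρ) (M' : Glider F ρ') : Glider F (ρ.tprod ρ') where
  space i := Submodule.map₂ (TensorProduct.mk ℂ Ω Ω') (M.space i) (M'.space i)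
  anti _ _ h := Submodule.map₂_le_map₂ (M.anti h) (M'.anti h)
  act_mem i j hij g hg m hm := by
    have h : Submodule.map₂ (TensorProduct.mk ℂ Ω Ω') (M.space j) (M'.space j) ≤
        (Submodule.map₂ (TensorProduct.mk ℂ Ω Ω') (M.space (j - i)) (M'.space (j - i))).comap
          (ρ.tprod ρ' g) := by
      rw [Submodule.map₂_le]
      intro a ha b hb
      exact Submodule.apply_mem_map₂ _ (M.act_mem i j hij g hg a ha)
        (M'.act_mem i j hij g hg b hb)
    exact h hm

/-- The `ℂ[G]`-submodule `ℂ[G] M₁` generated by `M₁`. -/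
def Glider.gen {G Ω : Type*} [Group G] [AddCommGroup Ω] [Module ℂ Ω] {F : ℕ → Subgroup G}
    {ρ : Representation ℂ G Ω} (M : Glider F ρ) : Submodule ℂ Ω :=
  Submodule.span ℂ {w | ∃ g : G, ∃ m ∈ M.space 1, w = ρ g m}

section Abelian

variable {G : Type*} [CommGroup G] (φ : G ≃* (G →* ℂˣ))

/-- The basis vector `t_g` of `⨁_{g ∈ G} T_g`, realised as the functions `G → ℂ`. -/
def basisVec {G : Type*} (g : G) : G → ℂ := Set.indicator {g} 1

/-- The representation `⨁_{g ∈ G} T_g`, where `T_g = ℂ t_g` is the one-dimensional representation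
with character `φ g`. -/
def sumRep : Representation ℂ G (G → ℂ) where
  toFun g := LinearMap.pi fun a => ((φ a g : ℂˣ) : ℂ) • LinearMap.proj a
  map_one' := by
    ext f a
    simp
  map_mul' g h := by
    ext f a
    simp [mul_assoc]

theorem sumRep_basisVec (g a : G) :
    sumRep φ g (basisVec a) = ((φ a g : ℂˣ) : ℂ) • basisVec a := by
  ext x
  by_cases h : x = a
  · subst h; simp [sumRep, basisVec]
  · simp [sumRep, basisVec, h]

theorem indicator_eq_sum {G : Type*} [Fintype G] (A : Set G) [DecidablePred (· ∈ A)] :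
    A.indicator (1 : G → ℂ) = ∑ a ∈ Finset.univ.filter (· ∈ A), basisVec a := by
  ext x
  classical
  have h : ∀ c : G, basisVec c x = if c = x then (1 : ℂ) else 0 := fun c => by
    by_cases hc : c = x
    · simp [basisVec, hc]
    · simp [basisVec, hc, Ne.symm hc]
  simp [Finset.sum_apply, h, Set.indicator_apply]

theorem sumRep_indicator_mem [Finite G] (A : Set G) (g : G) :
    sumRep φ g (A.indicator 1) ∈ Submodule.span ℂ (basisVec '' {a | a ∈ A ∨ (A = ∅ ∧ a = 1)}) := by
  classical
  have := Fintype.ofFinite G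
  rw [indicator_eq_sum, map_sum]
  refine Submodule.sum_mem _ fun a ha => ?_
  rw [sumRep_basisVec]
  exact Submodule.smul_mem _ _ (Submodule.subset_span ⟨a, Or.inl (by simpa using ha), rfl⟩)

/-- The irreducible glider `⨁_{g ∈ A} T_g ⊇ ℂ ∑_{g ∈ A} t_g ⊇ 0 ⊇ ⋯` attached to a nonempty subset
`A` of `G`, and the glider `ℂ ⊇ 0 ⊇ ⋯` for `A = ∅`. (In the latter the line `ℂ` is taken to be
`T_1`; `1` being the only group element acting on it within the glider, the choice is immaterial.)
-/
def subsetGlider [Finite G] (A : Set G) : Glider (shortChain G) (sumRep φ) where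
  space
    | 0 => Submodule.span ℂ
        (basisVec '' {a | a ∈ A ∨ (A = ∅ ∧ a = 1)})
    | 1 => Submodule.span ℂ {A.indicator 1}
    | _ + 2 => ⊥
  anti := by
    refine antitone_nat_of_succ_le fun n => ?_
    match n with
    | 0 =>
      refine (Submodule.span_singleton_le_iff_mem _ _).mpr ?_
      simpa using sumRep_indicator_mem φ A 1
    | 1 => exact bot_le
    | _ + 2 => exact bot_le
  act_mem i j hij g hg m hm := by
    match i, j with
    | 0, j =>
      obtain rfl : g = 1 := Subgroup.mem_bot.mp hg
      simpa using hm
    | 1, 1 =>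
      obtain ⟨c, rfl⟩ := Submodule.mem_span_singleton.mp hm
      rw [map_smul]
      exact Submodule.smul_mem _ _ (sumRep_indicator_mem φ A g)
    | i + 1, j + 2 =>
      obtain rfl : m = 0 := (Submodule.mem_bot ℂ).mp hm
      simp
    | i + 2, 1 => omega

/-- The set of those `g ∈ G` for which the irreducible representation `T_g` occurs in
`ℂ[G] M₁`. -/
def support {Ω : Type*} [AddCommGroup Ω] [Module ℂ Ω] {ρ : Representation ℂ G Ω}
    (M : Glider (shortChain G) ρ) : Set G :=
  {x | ∃ w ∈ M.gen, w ≠ 0 ∧ ∀ g : G, ρ g w = ((φ x g : ℂˣ) : ℂ) • w}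

open Classical in
/-- The generalized character of a glider `M₀ ⊇ M₁ ⊇ 0 ⊇ ⋯` for `1 < G` with `dim M₁ ≤ 1`, as a
combination of irreducible ones: if `M₁ = 0` then `M` is the sum of `dim M₀` copies of `ℂ ⊇ 0`;
otherwise it is the fragment direct sum of the irreducible glider `ℂ[G] M₁ ⊇ M₁` and of
`dim M₀ - dim ℂ[G] M₁` copies of `ℂ ⊇ 0`. -/
def gliderChar {Ω : Type*} [AddCommGroup Ω] [Module ℂ Ω] {ρ : Representation ℂ G Ω}
    (M : Glider (shortChain G) ρ) : Set G →₀ ℤ :=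
  if M.space 1 = ⊥ then Finsupp.single ∅ (Module.finrank ℂ (M.space 0) : ℤ)
  else Finsupp.single (support φ M) 1 +
    Finsupp.single ∅ ((Module.finrank ℂ (M.space 0) : ℤ) - Module.finrank ℂ M.gen)

/-- The generalized character ring `R(G̃)`: as an additive group it is free on the characters
`χ_A` of the irreducible gliders, labelled by the subsets `A` of `G`. -/
def CharRing {G : Type*} [CommGroup G] (_φ : G ≃* (G →* ℂˣ)) : Type _ := Set G →₀ ℤ

instance instAddCommGroupCharRing : AddCommGroup (CharRing φ) := inferInstanceAs (AddCommGroup (Set G →₀ ℤ))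

/-- The biadditive multiplication with `χ_A χ_B = χ_{M ⊗ M'}`, where `M`, `M'` are the gliders
attached to `A`, `B`. -/
def mulLin [Finite G] : (Set G →₀ ℤ) →ₗ[ℤ] (Set G →₀ ℤ) →ₗ[ℤ] (Set G →₀ ℤ) :=
  Finsupp.lift _ ℤ _ fun A => Finsupp.lift _ ℤ _ fun B =>
    gliderChar φ ((subsetGlider φ A).tensor (subsetGlider φ B))

/-! Computation of the tensor product of two irreducible gliders, which yields the ring axioms. -/

theorem char_orthogonality [Fintype G] [DecidableEq G] (c d : G) :
    ∑ g : G, (((φ c g)⁻¹ : ℂˣ) : ℂ) * ((φ d g : ℂˣ) : ℂ) =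
      if c = d then (Fintype.card G : ℂ) else 0 := by
  classical
  have h := sum_hom_units ((Units.coeHom ℂ).comp (φ (c⁻¹ * d)))
  have h1 : ((Units.coeHom ℂ).comp (φ (c⁻¹ * d)) = 1) ↔ c = d := by
    constructor
    · intro h
      have : φ (c⁻¹ * d) = 1 := by
        ext g
        simpa using DFunLike.congr_fun h g
      rw [EmbeddingLike.map_eq_one_iff] at this
      exact (inv_mul_eq_one.mp this)
    · rintro rfl
      ext g
      simp
  simp only [h1] at h
  rw [← Nat.cast_zero, ← Nat.cast_ite, ← h]
  refine Finset.sum_congr rfl fun g _ => ?_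
  simp

theorem cyclic_aux [Finite G] {W ι : Type*} [AddCommGroup W] [Module ℂ W] [Finite ι]
    (b : Module.Basis ι ℂ W) (σ : Representation ℂ G W) (l : ι → G)
    (hσ : ∀ g i, σ g (b i) = ((φ (l i) g : ℂˣ) : ℂ) • b i) (s : Finset ι) :
    Module.finrank ℂ (Submodule.span ℂ (Set.range fun g => σ g (∑ i ∈ s, b i))) =
      (l '' (s : Set ι)).ncard ∧
    {x | ∃ w ∈ Submodule.span ℂ (Set.range fun g => σ g (∑ i ∈ s, b i)),
      w ≠ 0 ∧ ∀ g : G, σ g w = ((φ x g : ℂˣ) : ℂ) • w} = l '' (s : Set ι) := by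
  classical
  have := Fintype.ofFinite G
  have := Fintype.ofFinite ι
  set W' := Submodule.span ℂ (Set.range fun g => σ g (∑ i ∈ s, b i)) with hW'
  let u : G → W := fun c => ∑ i ∈ s, if l i = c then b i else 0
  have hv : ∀ g, σ g (∑ i ∈ s, b i) = ∑ i ∈ s, ((φ (l i) g : ℂˣ) : ℂ) • b i := by
    intro g
    rw [map_sum]
    exact Finset.sum_congr rfl fun i _ => hσ g i
  have hu : ∀ c, u c ∈ W' := by
    intro c
    have h : (Fintype.card G : ℂ) • u c =
        ∑ g : G, (((φ c g)⁻¹ : ℂˣ) : ℂ) • σ g (∑ i ∈ s, b i) := by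
      simp only [hv, Finset.smul_sum, smul_smul, u]
      rw [Finset.sum_comm]
      refine Finset.sum_congr rfl fun i _ => ?_
      rw [← Finset.sum_smul, char_orthogonality]
      by_cases hc : c = l i
      · simp [hc]
      · simp [hc, Ne.symm hc]
    have h0 : (Fintype.card G : ℂ) ≠ 0 := by simp
    rw [← Submodule.smul_mem_iff _ h0, h]
    exact Submodule.sum_mem _ fun g _ =>
      Submodule.smul_mem _ _ (Submodule.subset_span ⟨g, rfl⟩)
  have hr : ∀ c i, b.repr (u c) i = if i ∈ s ∧ l i = c then 1 else 0 := by
    intro c i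
    simp only [u, map_sum, Finsupp.finsetSum_apply]
    by_cases hi : i ∈ s
    · rw [Finset.sum_eq_single i]
      · by_cases h : l i = c <;> simp [h, hi]
      · intro j _ hj
        by_cases h : l j = c <;> simp [h, hj]
      · exact fun h => absurd hi h
    · rw [Finset.sum_eq_zero]
      · simp [hi]
      · intro j hj
        have : j ≠ i := fun h => hi (h ▸ hj)
        by_cases h : l j = c <;> simp [h, this]
  have hspan : W' = Submodule.span ℂ (Set.range fun c : s.image l => u c) := by
    apply le_antisymm
    · rw [hW', Submodule.span_le]
      rintro _ ⟨g, rfl⟩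
      have h : σ g (∑ i ∈ s, b i) = ∑ c ∈ s.image l, ((φ c g : ℂˣ) : ℂ) • u c := by
        rw [hv]
        simp only [u, Finset.smul_sum]
        rw [Finset.sum_comm]
        refine Finset.sum_congr rfl fun i hi => ?_
        rw [Finset.sum_eq_single (l i)]
        · simp
        · intro c _ hc
          simp [Ne.symm hc]
        · exact fun h => absurd (Finset.mem_image_of_mem l hi) h
      simp only [SetLike.mem_coe]
      rw [h]
      exact Submodule.sum_mem _ fun c hc =>
        Submodule.smul_mem _ _ (Submodule.subset_span ⟨⟨c, hc⟩, rfl⟩)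
    · rw [Submodule.span_le]
      rintro _ ⟨c, rfl⟩
      exact hu c
  have hli : LinearIndependent ℂ (fun c : s.image l => u c) := by
    rw [Fintype.linearIndependent_iff]
    rintro f hf ⟨c, hc⟩
    obtain ⟨i, hi, rfl⟩ := Finset.mem_image.mp hc
    have h := congrArg (fun w => b.repr w i) hf
    simp only [map_sum, map_smul, Finsupp.finsetSum_apply, Finsupp.smul_apply, hr, map_zero,
      Finsupp.zero_apply] at h
    rw [Finset.sum_eq_single ⟨l i, hc⟩] at h
    · simpa [hi] using h
    · rintro ⟨d, hd⟩ _ hne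
      have : l i ≠ d := fun h => hne (Subtype.ext h.symm)
      simp [this]
    · exact fun h => absurd (Finset.mem_univ _) h
  constructor
  · rw [hspan, finrank_span_eq_card hli, ← Finset.coe_image, Set.ncard_coe_finset,
      Fintype.card_coe]
  · ext x
    simp only [Set.mem_ofPred_eq, Set.mem_image, Finset.mem_coe]
    constructor
    · rintro ⟨w, hw, hw0, hx⟩
      obtain ⟨i, hi⟩ : ∃ i, b.repr w i ≠ 0 := by
        by_contra! h
        exact hw0 (b.repr.map_eq_zero_iff.mp (Finsupp.ext h))
      refine ⟨i, ?_, ?_⟩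
      · by_contra his
        have hle : W' ≤ LinearMap.ker (b.coord i) := by
          rw [hspan, Submodule.span_le]
          rintro _ ⟨c, rfl⟩
          simp [hr, his]
        exact hi (by simpa using hle hw)
      · have hσr : ∀ g, b.repr (σ g w) i = ((φ (l i) g : ℂˣ) : ℂ) * b.repr w i := by
          intro g
          conv_lhs => rw [← b.sum_repr w]
          simp only [map_sum, map_smul, hσ, Finsupp.finsetSum_apply, Finsupp.smul_apply,
            Module.Basis.repr_self]
          rw [Finset.sum_eq_single i]
          · simp [mul_comm]
          · intro j _ hj
            simp [hj]
          · exact fun h => absurd (Finset.mem_univ _) h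
        apply φ.injective
        ext g
        have h := hσr g
        rw [hx g, map_smul, Finsupp.smul_apply, smul_eq_mul] at h
        exact (mul_right_cancel₀ hi h).symm
    · rintro ⟨i, hi, rfl⟩
      refine ⟨u (l i), hu _, ?_, ?_⟩
      · intro h
        have h' := hr (l i) i
        simp [h, hi] at h'
      · intro g
        simp only [u, map_sum, Finset.smul_sum]
        refine Finset.sum_congr rfl fun j _ => ?_
        by_cases h : l j = l i
        · simp [h, hσ]
        · simp [h]

theorem basisVec_eq {G : Type*} [Finite G] (a : G) : basisVec a = Pi.basisFun ℂ G a := by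
  classical
  ext x
  by_cases h : x = a
  · subst h; simp [basisVec]
  · simp [basisVec, h]

/-- The dimension of `M₀` for the glider attached to `A`. -/
def dim (A : Set G) : ℤ := Set.ncard {a | a ∈ A ∨ (A = ∅ ∧ a = 1)}

theorem gliderChar_tensor [Finite G] (A B : Set G) :
    gliderChar φ ((subsetGlider φ A).tensor (subsetGlider φ B)) =
      Finsupp.single (A * B) 1 + Finsupp.single ∅ (dim A * dim B - dim (A * B)) := by
  classical
  have := Fintype.ofFinite G
  let b := (Pi.basisFun ℂ G).tensorProduct (Pi.basisFun ℂ G)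
  have hb : ∀ x y : G, b (x, y) = basisVec x ⊗ₜ[ℂ] basisVec y := by
    intro x y
    simp only [b, Module.Basis.tensorProduct_apply, basisVec_eq]
  set M := (subsetGlider φ A).tensor (subsetGlider φ B) with hM
  have h0 : (Module.finrank ℂ (M.space 0) : ℤ) = dim A * dim B := by
    have : M.space 0 = Submodule.span ℂ (b ''
        ({a | a ∈ A ∨ (A = ∅ ∧ a = 1)} ×ˢ {a | a ∈ B ∨ (B = ∅ ∧ a = 1)})) := by
      simp only [hM, Glider.tensor, subsetGlider, Submodule.map₂_span_span]
      congr 1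
      ext w
      constructor
      · rintro ⟨_, ⟨x, hx, rfl⟩, _, ⟨y, hy, rfl⟩, rfl⟩
        exact ⟨(x, y), ⟨hx, hy⟩, hb x y⟩
      · rintro ⟨⟨x, y⟩, ⟨hx, hy⟩, rfl⟩
        exact ⟨_, ⟨x, hx, rfl⟩, _, ⟨y, hy, rfl⟩, (hb x y).symm⟩
    have hli : ∀ S : Set (G × G), Module.finrank ℂ
        (Submodule.span ℂ (Set.range fun x : S => b (x : G × G))) = S.ncard := by
      intro S
      have := Fintype.ofFinite S
      rw [← Nat.card_coe_set_eq, Nat.card_eq_fintype_card]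
      exact finrank_span_eq_card
        (b.linearIndependent.comp (fun x : S => (x : G × G)) Subtype.val_injective)
    rw [this, Set.image_eq_range, hli, dim, dim, ← Nat.cast_mul, ← Set.ncard_prod]
  have h1 : M.space 1 = Submodule.span ℂ {A.indicator 1 ⊗ₜ[ℂ] B.indicator 1} := by
    simp only [hM, Glider.tensor, subsetGlider, Submodule.map₂_span_span, Set.image2_singleton,
      TensorProduct.mk_apply]
  have hv : A.indicator (1 : G → ℂ) ⊗ₜ[ℂ] B.indicator (1 : G → ℂ) =
      ∑ i ∈ (A ×ˢ B).toFinset, b i := by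
    rw [indicator_eq_sum, indicator_eq_sum, TensorProduct.sum_tmul]
    simp only [TensorProduct.tmul_sum]
    rw [← Finset.sum_product']
    refine Finset.sum_congr ?_ fun i _ => (hb i.1 i.2).symm
    ext i
    simp
  have hgen : M.gen = Submodule.span ℂ (Set.range fun g =>
      ((sumRep φ).tprod (sumRep φ)) g (∑ i ∈ (A ×ˢ B).toFinset, b i)) := by
    rw [Glider.gen, h1, hv]
    apply le_antisymm
    · rw [Submodule.span_le]
      rintro _ ⟨g, m, hm, rfl⟩
      obtain ⟨c, rfl⟩ := Submodule.mem_span_singleton.mp hm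
      rw [map_smul]
      exact Submodule.smul_mem _ _ (Submodule.subset_span ⟨g, rfl⟩)
    · rw [Submodule.span_le]
      rintro _ ⟨g, rfl⟩
      exact Submodule.subset_span ⟨g, _, Submodule.mem_span_singleton_self _, rfl⟩
  have hσ : ∀ g i, ((sumRep φ).tprod (sumRep φ)) g (b i) =
      ((φ (i.1 * i.2) g : ℂˣ) : ℂ) • b i := by
    rintro g ⟨x, y⟩
    rw [hb, Representation.tprod_apply, TensorProduct.map_tmul, sumRep_basisVec, sumRep_basisVec,
      TensorProduct.smul_tmul_smul, map_mul, MonoidHom.mul_apply, Units.val_mul]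
  obtain ⟨c1, c2⟩ := cyclic_aux φ b ((sumRep φ).tprod (sumRep φ)) (fun i => i.1 * i.2) hσ
    (A ×ˢ B).toFinset
  have himg : (fun i : G × G => i.1 * i.2) '' ((A ×ˢ B).toFinset : Set (G × G)) = A * B := by
    rw [Set.coe_toFinset, Set.image_mul_prod]
  rw [himg, ← hgen] at c1 c2
  have hsupp : support φ M = A * B := c2
  have hdim : ∀ C : Set G, C.Nonempty → dim C = C.ncard := by
    intro C hC
    simp [dim, hC.ne_empty]
  rcases Set.eq_empty_or_nonempty (A * B) with h | h
  · have hs : (A ×ˢ B).toFinset = ∅ := by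
      rcases Set.mul_eq_empty.mp h with h | h <;> simp [h]
    have hbot : M.space 1 = ⊥ := by
      rw [h1, hv, hs]
      simp
    have hd : dim (∅ : Set G) = 1 := by simp [dim]
    rw [gliderChar, if_pos hbot, h0, h, hd, ← Finsupp.single_add]
    congr 1
    ring
  · have hbot : M.space 1 ≠ ⊥ := by
      intro hbot
      have : M.gen = ⊥ := by
        rw [Glider.gen, hbot, Submodule.span_eq_bot]
        rintro _ ⟨g, m, hm, rfl⟩
        rw [(Submodule.mem_bot ℂ).mp hm, map_zero]
      rw [this, finrank_bot] at c1
      exact (h.ncard_pos (Set.toFinite _)).ne c1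
    rw [gliderChar, if_neg hbot, h0, hsupp, c1, hdim _ h]

/-! ### The ring structure -/

theorem mulLin_single [Finite G] (A B : Set G) (a b : ℤ) :
    mulLin φ (Finsupp.single A a) (Finsupp.single B b) =
      (a * b) • (Finsupp.single (A * B) 1 + Finsupp.single ∅ (dim A * dim B - dim (A * B))) := by
  rw [← gliderChar_tensor φ]
  simp [mulLin, smul_smul, mul_comm]

theorem dim_empty : dim (∅ : Set G) = 1 := by simp [dim]

theorem dim_one : dim (1 : Set G) = 1 := by simp [dim, Set.one_nonempty.ne_empty]

theorem mulLin_comm [Finite G] (x y : Set G →₀ ℤ) : mulLin φ x y = mulLin φ y x := by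
  induction x using Finsupp.induction_linear with
  | zero => simp
  | add f g hf hg => simp [hf, hg]
  | single A a =>
    induction y using Finsupp.induction_linear with
    | zero => simp
    | add f g hf hg => simp [hf, hg]
    | single B b => rw [mulLin_single, mulLin_single, mul_comm A, mul_comm a, mul_comm (dim A)]

theorem mulLin_assoc [Finite G] (x y z : Set G →₀ ℤ) :
    mulLin φ (mulLin φ x y) z = mulLin φ x (mulLin φ y z) := by
  induction x using Finsupp.induction_linear with
  | zero => simp
  | add f g hf hg => simp [hf, hg]
  | single A a =>
    induction y using Finsupp.induction_linear with
    | zero => simp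
    | add f g hf hg => simp [hf, hg]
    | single B b =>
      induction z using Finsupp.induction_linear with
      | zero => simp
      | add f g hf hg => simp only [map_add, hf, hg]
      | single C c =>
        simp only [mulLin_single, map_smul, map_add, LinearMap.add_apply, LinearMap.smul_apply,
          Set.mul_empty, Set.empty_mul, dim_empty, mul_assoc A B C]
        simp only [← Finsupp.single_add, Finsupp.smul_single, smul_add, smul_eq_mul, add_assoc]
        congr 2 <;> ring

theorem mulLin_one [Finite G] (x : Set G →₀ ℤ) : mulLin φ (Finsupp.single 1 1) x = x := by
  induction x using Finsupp.induction_linear with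
  | zero => simp
  | add f g hf hg => simp [hf, hg]
  | single A a => simp [mulLin_single, dim_one]

/-- The character `χ_A ∈ R(G̃)` of the irreducible glider attached to `A`. -/
def chi (A : Set G) : CharRing φ := Finsupp.single A (1 : ℤ)

/-- The ring structure on `R(G̃)`; its unit is `χ_{1}`. -/
instance instCommRingCharRing [Finite G] : CommRing (CharRing φ) where
  __ := (inferInstance : AddCommGroup (CharRing φ))
  mul x y := mulLin φ x y
  one := chi φ {1}
  left_distrib x y z := map_add (mulLin φ x) y z
  right_distrib x y z := LinearMap.map_add₂ (mulLin φ) x y z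
  zero_mul x := LinearMap.map_zero₂ (mulLin φ) x
  mul_zero x := map_zero (mulLin φ x)
  mul_assoc := mulLin_assoc φ
  mul_comm := mulLin_comm φ
  one_mul := mulLin_one φ
  mul_one x := (mulLin_comm φ _ _).trans (mulLin_one φ x)

/-- The product formula, in terms of the cardinalities of nonempty sets. -/
theorem chi_mul_chi [Finite G] {A B : Set G} (hA : A.Nonempty) (hB : B.Nonempty) :
    chi φ A * chi φ B =
      chi φ (A * B) + ((A.ncard : ℤ) * B.ncard - (A * B).ncard) • chi φ ∅ := by
  refine (mulLin_single φ A B 1 1).trans ?_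
  rw [one_mul, one_smul]
  congr 1
  refine Eq.trans ?_ (Finsupp.smul_single _ _ _).symm
  simp [dim, hA.ne_empty, hB.ne_empty, (hA.mul hB).ne_empty]

/-! ### The algebras `ℚ(G̃)` -/

/-- `ℚ(G̃) = ℚ ⊗_ℤ R(G̃)`, where `R(G̃)` is taken modulo the ideal generated by `χ_∅`. -/
abbrev RatAlg [Finite G] : Type _ := ℚ ⊗[ℤ] (CharRing φ ⧸ Ideal.span {chi φ ∅})

/-- The element `χ_A` of `ℚ(G̃)`. -/
def ratChi [Finite G] (A : Set G) : RatAlg φ :=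
  (1 : ℚ) ⊗ₜ[ℤ] Ideal.Quotient.mk (Ideal.span {chi φ ∅}) (chi φ A)

/-- The contracted algebra: `ℚ(G̃)` modulo its ideal generated by the zero element `χ_G`. -/
abbrev ContrAlg [Finite G] : Type _ := RatAlg φ ⧸ Ideal.span {ratChi φ Set.univ}

/-- The element `χ_A` of the contracted algebra. -/
def contrChi [Finite G] (A : Set G) : ContrAlg φ :=
  Ideal.Quotient.mk (Ideal.span {ratChi φ Set.univ}) (ratChi φ A)

end Abelian

/-! ### The ideal `I` and the idempotents -/

/-- The idempotents of the cyclic semigroup `⟨A⟩ = {A, A², A³, …}` of subsets of `G`. -/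
def powerIdempotents {G : Type*} [CommGroup G] (A : Set G) : Set (Set G) :=
  {E | (∃ k : ℕ, 1 ≤ k ∧ E = A ^ k) ∧ IsIdempotentElem E}

/-- `n(A) = E`: the set `E` is a minimal idempotent in `⟨A⟩`, for the order on idempotents
`e ≤ f ↔ e = e f = f e`. -/
def IsMinIdempotent {G : Type*} [CommGroup G] (A E : Set G) : Prop :=
  E ∈ powerIdempotents A ∧ ∀ F ∈ powerIdempotents A, (F = F * E ∧ F = E * F) → F = E

/-- The ideal generated by the elements `χ_{gH} - χ_A`, for `A` a nonempty subset of `G`, `H` the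
subgroup `n(A)` and `gH` the coset containing `A`; here `c A` is the element `χ_A`. -/
def cosetIdeal {G R : Type*} [CommGroup G] [CommRing R] (c : Set G → R) : Ideal R :=
  Ideal.span {x | ∃ (A : Set G) (g : G) (H : Subgroup G), A.Nonempty ∧
    IsMinIdempotent A (H : Set G) ∧ A ⊆ g • (H : Set G) ∧ x = c (g • (H : Set G)) - c A}

/-- The product `∏ (χ_H - χ_{H'})` over all subgroups `H'` of `G` containing `H` such that `H'/H` is
a minimal nontrivial subgroup of `G/H`; here `c A` is the element `χ_A`. -/
def unitImage {G R : Type*} [CommGroup G] [Finite G] [CommRing R] (c : Set G → R)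
    (H : Subgroup G) : R :=
  ∏ L ∈ (Set.toFinite {L : Subgroup (G ⧸ H) | IsAtom L}).toFinset,
    (c (H : Set G) - c (L.comap (QuotientGroup.mk' H) : Set G))

end GliderRing

end

noncomputable section

namespace GliderRing

/-! ### Subsets of `G`, their idempotent powers and the cosets that contain them. -/

section Subsets

variable {G : Type*} [CommGroup G]

/-! Modulo `χ_∅` the correction term in the product formula disappears, so `ℚ(G̃)` is spanned by a
multiplicative image of the monoid of subsets of `G`, with the empty set as zero. For each subgroup
`K`, sending `A` to the coset of `K` containing it, or to `0` if there is none, is multiplicative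
(`cosetValue_mul`). Together these maps give `Ψ : ℚ(G̃) → ∏ ℚ(G/K)`, and everything follows by
comparing `I`, `ker Ψ` and `J`.

If `H = A ^ k` and `A ⊆ gH`, then `A` and `gH` lie in the same cosets of every `K`
(`subset_coset_iff_of_pow_eq`), so `I ⊆ ker Ψ`. Each generator of `I` is nilpotent
(`pow_sub_eq_zero`), so `I ⊆ J`.

`Ψ` is onto: `ψ_H` maps to the unit of the factor at `H`, because `χ_L` has value `1` at `K` if `L ≤
K` and `0` otherwise (`map_unitImage_single`). The target is semisimple by Maschke, so `J ⊆ ker Ψ`.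
Finally, modulo `I` the algebra is spanned by the `χ_{gH}`, and there are exactly as many cosets
`gH` as the dimension of the target; hence `ker Ψ = I` (`ker_eq_cosetIdeal`).

The contracted algebra is treated by the same argument: `χ_G` has value `0` at every proper
subgroup, and only the factor at `G` is dropped. -/

theorem smul_coe_mul_of_subset {H : Subgroup G} {A : Set G} {g : G} (hA : A.Nonempty)
    (h : A ⊆ g • (H : Set G)) : g • (H : Set G) * A = g • (H : Set G) * g • (H : Set G) := by
  refine (Set.mul_subset_mul_left h).antisymm ?_
  obtain ⟨a, ha⟩ := hA
  obtain ⟨u, hu, rfl⟩ := h ha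
  rintro _ ⟨_, ⟨x, hx, rfl⟩, _, ⟨y, hy, rfl⟩, rfl⟩
  refine ⟨_, ⟨x * y * u⁻¹, H.mul_mem (H.mul_mem hx hy) (H.inv_mem hu), rfl⟩, _, ha, ?_⟩
  simp only [smul_eq_mul]
  calc g * (x * y * u⁻¹) * (g * u) = g * x * (g * y) * (u⁻¹ * u) := by ac_rfl
    _ = _ := by simp

/-- The power is `g ^ k • H`, and it contains `A ^ k = H`, hence `1`; therefore `g ^ k ∈ H`. -/
theorem coset_pow_of_pow_eq {H : Subgroup G} {A : Set G} {g : G} {k : ℕ} (hk : k ≠ 0)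
    (h : A ⊆ g • (H : Set G)) (hA : (H : Set G) = A ^ k) : (g • (H : Set G)) ^ k = H := by
  rw [smul_pow, coe_set_pow hk]
  have h1 : (1 : G) ∈ (g • (H : Set G)) ^ k := Set.pow_subset_pow_left h (hA ▸ H.one_mem)
  rw [smul_pow, coe_set_pow hk] at h1
  obtain ⟨u, hu, h1⟩ := h1
  have hg : g ^ k ∈ H := by
    rw [eq_inv_of_mul_eq_one_left h1]
    exact H.inv_mem hu
  exact smul_coe_set hg

/-- The powers of `A` are eventually periodic, so one of them is idempotent, and a nonempty
idempotent subset of a finite group is a subgroup. -/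
theorem exists_isMinIdempotent [Finite G] {A : Set G} (hA : A.Nonempty) :
    ∃ (g : G) (H : Subgroup G), IsMinIdempotent A (H : Set G) ∧ A ⊆ g • (H : Set G) := by
  obtain ⟨k, hk, hid⟩ : ∃ k : ℕ, 1 ≤ k ∧ IsIdempotentElem (A ^ k) := by
    obtain ⟨m, n, hmn, h⟩ := Finite.exists_ne_map_eq_of_infinite fun n : ℕ => A ^ n
    wlog hlt : m < n generalizing m n
    · exact this n m hmn.symm h.symm (by omega)
    obtain ⟨p, rfl⟩ := Nat.exists_eq_add_of_lt hlt
    have h1 : ∀ j t, A ^ (m + j + t * (p + 1)) = A ^ (m + j) := by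
      intro j t
      induction t with
      | zero => simp
      | succ t ih =>
        rw [← ih, show m + j + (t + 1) * (p + 1) = (m + p + 1) + (j + t * (p + 1)) by ring,
          pow_add, ← h, ← pow_add, add_assoc]
    -- The exponent `(m + 1) * (p + 1)` is a multiple of the period `p + 1` and is at least `m`, so
    -- doubling it does not change the power.
    have h2 := h1 ((m + 1) * (p + 1) - m) (m + 1)
    have h3 : m + ((m + 1) * (p + 1) - m) = (m + 1) * (p + 1) := by
      have : m ≤ (m + 1) * (p + 1) := by nlinarith
      omega
    rw [h3] at h2
    exact ⟨(m + 1) * (p + 1), Nat.mul_pos (by omega) (by omega), by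
      rw [IsIdempotentElem, ← pow_add, h2]⟩
  obtain ⟨g, hg⟩ := id hA
  refine ⟨g, subgroupOfIdempotent (A ^ k) hA.pow hid, ⟨⟨⟨k, hk, rfl⟩, hid⟩, ?_⟩, ?_⟩
  -- The idempotent power is unique: `A ^ j = (A ^ j) ^ k = (A ^ k) ^ j = A ^ k`.
  · rintro F ⟨⟨j, hj, rfl⟩, hF⟩ -
    have h1 := hid.pow_eq (Nat.ne_of_gt hj)
    have h2 := hF.pow_eq (Nat.ne_of_gt hk)
    change A ^ j = A ^ k
    rw [← h1, ← h2, ← pow_mul, ← pow_mul, mul_comm]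
  · intro a ha
    -- Multiplication by a fixed `b ∈ A ^ (k - 1)` moves `A` into `A ^ k = H`, so `g⁻¹ * a = (g *
    -- b)⁻¹ * (a * b)` lies in `H`.
    obtain ⟨b, hb⟩ := hA.pow (n := k - 1)
    have hmem : ∀ x ∈ A, x * b ∈ subgroupOfIdempotent (A ^ k) hA.pow hid := by
      intro x hx
      have : x * b ∈ A ^ (1 + (k - 1)) := by
        rw [pow_add, pow_one]
        exact Set.mul_mem_mul hx hb
      rwa [show 1 + (k - 1) = k by omega] at this
    rw [Set.mem_smul_set_iff_inv_smul_mem]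
    have := mul_mem (inv_mem (hmem g hg)) (hmem a ha)
    simpa [mul_comm, mul_assoc, mul_left_comm] using this

/-- If `A ⊆ xK`, then `H = A ^ k ⊆ x ^ k K`. Since `1 ∈ H`, this coset is `K`, so `H ≤ K`; thus `gH`
lies in one coset of `K`, which is `xK` because the two meet in `A`. -/
theorem subset_coset_iff_of_pow_eq {H K : Subgroup G} {A : Set G} {g : G} {k : ℕ} (hk : k ≠ 0)
    (hA : A.Nonempty) (h : A ⊆ g • (H : Set G)) (hpow : (H : Set G) = A ^ k) (x : G) :
    A ⊆ x • (K : Set G) ↔ g • (H : Set G) ⊆ x • (K : Set G) := by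
  refine ⟨fun hx => ?_, h.trans⟩
  have h1 : (H : Set G) ⊆ x ^ k • (K : Set G) := by
    rw [hpow, ← coe_set_pow (H := K) hk, ← smul_pow]
    exact Set.pow_subset_pow_left hx
  have hxk : (x ^ k)⁻¹ ∈ K := by
    simpa [Set.mem_smul_set_iff_inv_smul_mem] using h1 H.one_mem
  have hHK : H ≤ K := by
    intro y hy
    have := h1 hy
    rwa [smul_coe_set (K.inv_mem_iff.mp hxk)] at this
  obtain ⟨a, ha⟩ := hA
  have h2 := h ha
  have h3 := hx ha
  rw [Set.mem_smul_set_iff_inv_smul_mem] at h2 h3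
  rintro _ ⟨y, hy, rfl⟩
  rw [Set.mem_smul_set_iff_inv_smul_mem]
  have h4 := K.mul_mem h3 (K.mul_mem (K.inv_mem (hHK h2)) (hHK hy))
  have h5 : x⁻¹ • a * ((g⁻¹ • a)⁻¹ * y) = x⁻¹ • g • y := by
    simp only [smul_eq_mul, mul_inv_rev, inv_inv]
    calc x⁻¹ * a * (a⁻¹ * g * y) = x⁻¹ * (a * a⁻¹) * g * y := by simp only [mul_assoc]
      _ = _ := by simp [mul_assoc]
  rwa [← h5]

open Classical in
/-- The basis element of `ℚ(G/K)` belonging to the coset of `K` that contains the nonempty set `A`,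
and `0` if there is no such coset. -/
def cosetValue (K : Subgroup G) (A : Set G) : MonoidAlgebra ℚ (G ⧸ K) :=
  if h : A.Nonempty ∧ ∃ g : G, A ⊆ g • (K : Set G) then
    MonoidAlgebra.single (h.2.choose : G ⧸ K) 1 else 0

theorem mk_eq_of_mem_coset {K : Subgroup G} {g a : G} (h : a ∈ g • (K : Set G)) :
    (g : G ⧸ K) = a := by
  rw [QuotientGroup.eq]
  exact Set.mem_smul_set_iff_inv_smul_mem.mp h

theorem cosetValue_of_subset {K : Subgroup G} {A : Set G} {g : G} (hA : A.Nonempty)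
    (h : A ⊆ g • (K : Set G)) : cosetValue K A = MonoidAlgebra.single (g : G ⧸ K) 1 := by
  have h' : A.Nonempty ∧ ∃ g : G, A ⊆ g • (K : Set G) := ⟨hA, g, h⟩
  rw [cosetValue, dif_pos h']
  obtain ⟨a, ha⟩ := hA
  rw [mk_eq_of_mem_coset (h ha), mk_eq_of_mem_coset (h'.2.choose_spec ha)]

theorem cosetValue_of_not_subset {K : Subgroup G} {A : Set G}
    (h : ∀ g : G, ¬ A ⊆ g • (K : Set G)) : cosetValue K A = 0 := by
  rw [cosetValue, dif_neg]
  rintro ⟨-, g, hg⟩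
  exact h g hg

theorem cosetValue_empty (K : Subgroup G) : cosetValue K ∅ = 0 := by
  simp [cosetValue]

theorem cosetValue_singleton (K : Subgroup G) (g : G) :
    cosetValue K {g} = MonoidAlgebra.single (g : G ⧸ K) 1 :=
  cosetValue_of_subset (Set.singleton_nonempty g) (by
    rintro _ rfl
    exact ⟨1, K.one_mem, by simp⟩)

theorem cosetValue_coe_of_le {H K : Subgroup G} (h : H ≤ K) : cosetValue K (H : Set G) = 1 := by
  rw [cosetValue_of_subset (g := 1) ⟨1, H.one_mem⟩ (by simpa using h)]
  rfl

theorem cosetValue_coe_of_not_le {H K : Subgroup G} (h : ¬ H ≤ K) :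
    cosetValue K (H : Set G) = 0 := by
  refine cosetValue_of_not_subset fun g hg => h ?_
  have h1 : g⁻¹ ∈ K := by
    simpa [Set.mem_smul_set_iff_inv_smul_mem] using hg H.one_mem
  rwa [smul_coe_set (K.inv_mem_iff.mp h1)] at hg

/-- For nonempty sets, `A * B` lies in a coset of `K` exactly when both `A` and `B` do: translate by
an element of the other factor. -/
theorem cosetValue_mul (K : Subgroup G) (A B : Set G) :
    cosetValue K (A * B) = cosetValue K A * cosetValue K B := by
  rcases A.eq_empty_or_nonempty with rfl | hA
  · simp [cosetValue_empty]
  rcases B.eq_empty_or_nonempty with rfl | hB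
  · simp [cosetValue_empty]
  by_cases h : ∃ g : G, A * B ⊆ g • (K : Set G)
  · obtain ⟨g, hg⟩ := h
    obtain ⟨a, ha⟩ := id hA
    obtain ⟨b, hb⟩ := id hB
    have h1 : A ⊆ (g * b⁻¹) • (K : Set G) := by
      intro x hx
      have := hg (Set.mul_mem_mul hx hb)
      rw [Set.mem_smul_set_iff_inv_smul_mem] at this ⊢
      simpa [mul_comm, mul_assoc, mul_left_comm] using this
    have h2 : B ⊆ (g * a⁻¹) • (K : Set G) := by
      intro x hx
      have := hg (Set.mul_mem_mul ha hx)
      rw [Set.mem_smul_set_iff_inv_smul_mem] at this ⊢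
      simpa [mul_comm, mul_assoc, mul_left_comm] using this
    rw [cosetValue_of_subset (hA.mul hB) hg, cosetValue_of_subset hA h1,
      cosetValue_of_subset hB h2, MonoidAlgebra.single_mul_single, one_mul,
      mk_eq_of_mem_coset (h1 ha), mk_eq_of_mem_coset (h2 hb),
      mk_eq_of_mem_coset (hg (Set.mul_mem_mul ha hb)), QuotientGroup.mk_mul]
  · rw [cosetValue_of_not_subset (not_exists.mp h)]
    by_cases hA' : ∃ g : G, A ⊆ g • (K : Set G)
    · by_cases hB' : ∃ g : G, B ⊆ g • (K : Set G)
      · obtain ⟨x, hx⟩ := hA'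
        obtain ⟨y, hy⟩ := hB'
        refine absurd ⟨x * y, (Set.mul_subset_mul hx hy).trans ?_⟩ h
        rw [smul_mul_smul_comm, coe_mul_coe]
      · rw [cosetValue_of_not_subset (not_exists.mp hB'), mul_zero]
    · rw [cosetValue_of_not_subset (not_exists.mp hA'), zero_mul]

theorem cosetValue_coset_of_pow_eq {H : Subgroup G} {A : Set G} {g : G} {k : ℕ} (hk : k ≠ 0)
    (hA : A.Nonempty) (h : A ⊆ g • (H : Set G)) (hpow : (H : Set G) = A ^ k) (K : Subgroup G) :
    cosetValue K (g • (H : Set G)) = cosetValue K A := by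
  by_cases h' : ∃ x : G, A ⊆ x • (K : Set G)
  · obtain ⟨x, hx⟩ := h'
    rw [cosetValue_of_subset hA hx, cosetValue_of_subset (hA.mono h)
      ((subset_coset_iff_of_pow_eq hk hA h hpow x).mp hx)]
  · rw [cosetValue_of_not_subset (not_exists.mp h'), cosetValue_of_not_subset]
    intro x hx
    exact h' ⟨x, h.trans hx⟩

end Subsets

/-! ### Nilpotence of the generators of `I`. -/

section Ideal

variable {G R : Type*} [CommGroup G] [CommRing R]

/-- Since `y` annihilates `y - a`, powers of `y - a` reduce to `(-a) ^ (k - 1) * (y - a)`, which is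
`± (y ^ k - a ^ k)`. It is applied to `y = χ_{gH}` and `a = χ_A`. -/
theorem pow_sub_eq_zero {a y : R} (h : y * a = y * y) {k : ℕ} (hk : k ≠ 0) (hpow : y ^ k = a ^ k) :
    (y - a) ^ k = 0 := by
  obtain ⟨n, rfl⟩ := Nat.exists_eq_succ_of_ne_zero hk
  have h0 : ∀ n : ℕ, (y - a) ^ (n + 1) = (-a) ^ n * (y - a) := by
    intro n
    induction n with
    | zero => simp
    | succ n ih =>
      rw [pow_succ, ih]
      linear_combination (-a) ^ n * (-h)
  have h1 : ∀ n : ℕ, a ^ n * y = y ^ (n + 1) := by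
    intro n
    induction n with
    | zero => simp
    | succ n ih => linear_combination a * ih + y ^ n * h
  rw [Nat.succ_eq_add_one] at hpow ⊢
  rw [h0, neg_pow]
  linear_combination (-1) ^ n * (h1 n + hpow)

theorem cosetIdeal_le_jacobson (c : Set G →* R) : cosetIdeal c ≤ Ring.jacobson R := by
  refine (Ideal.span_le.mpr ?_).trans (nilradical_le_jacobson R)
  rintro _ ⟨A, g, H, hA, ⟨⟨⟨k, hk, hpow⟩, -⟩, -⟩, hsub, rfl⟩
  have hk' : k ≠ 0 := Nat.ne_of_gt hk
  refine ⟨k, pow_sub_eq_zero ?_ hk' ?_⟩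
  · rw [← map_mul, ← map_mul, smul_coe_mul_of_subset hA hsub]
  · rw [← map_pow, ← map_pow, coset_pow_of_pow_eq hk' hsub hpow, hpow]

end Ideal

theorem span_range_comp_eq_top {k S R R' : Type*} [CommSemiring k] [Semiring R] [Semiring R']
    [Algebra k R] [Algebra k R'] {c : S → R} (hc : Submodule.span k (Set.range c) = ⊤)
    {f : R →ₐ[k] R'} (hf : Function.Surjective f) : Submodule.span k (Set.range (f ∘ c)) = ⊤ := by
  have h := congrArg (Submodule.map f.toLinearMap) hc
  rwa [Submodule.map_span, ← Set.range_comp, Submodule.map_top,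
    LinearMap.range_eq_top.mpr hf] at h

/-! ### The radical and the semisimple quotient of an algebra spanned by images of subsets. -/

section Structure

variable {G R ι : Type*} [CommGroup G] [CommRing R] [Algebra ℚ R] {s : ι → Subgroup G} {c : Set G →* R}
  {Ψ : R →ₐ[ℚ] ((i : ι) → MonoidAlgebra ℚ (G ⧸ s i))}

theorem cosetIdeal_le_ker (hΨ : ∀ A i, Ψ (c A) i = cosetValue (s i) A) :
    cosetIdeal c ≤ RingHom.ker Ψ := by
  refine Ideal.span_le.mpr ?_
  rintro _ ⟨A, g, H, hA, ⟨⟨⟨k, hk, hpow⟩, -⟩, -⟩, hsub, rfl⟩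
  rw [SetLike.mem_coe, RingHom.mem_ker, map_sub, sub_eq_zero]
  ext1 i
  rw [hΨ, hΨ, cosetValue_coset_of_pow_eq (Nat.ne_of_gt hk) hA hsub hpow]

variable [DecidableEq ι]

theorem map_univ_single (hs : Function.Injective s)
    (hΨ : ∀ A i, Ψ (c A) i = cosetValue (s i) A) {i : ι} (hi : s i = ⊤) :
    Ψ (c Set.univ) = Pi.single i 1 := by
  ext1 j
  rw [hΨ, ← Subgroup.coe_top]
  rcases eq_or_ne j i with rfl | hji
  · rw [Pi.single_eq_same, cosetValue_coe_of_le hi.ge]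
  · rw [Pi.single_eq_of_ne hji, cosetValue_coe_of_not_le]
    exact fun h => hji (hs ((top_le_iff.mp h).trans hi.symm))

theorem map_singleton_mul_single (hΨ : ∀ A i, Ψ (c A) i = cosetValue (s i) A) (i : ι) (g : G) :
    Ψ (c {g}) * Pi.single i 1 = Pi.single i (MonoidAlgebra.single (g : G ⧸ s i) 1) := by
  ext1 j
  rw [Pi.mul_apply, hΨ, cosetValue_singleton]
  rcases eq_or_ne j i with rfl | hji
  · rw [Pi.single_eq_same, Pi.single_eq_same, mul_one]
  · rw [Pi.single_eq_of_ne hji, Pi.single_eq_of_ne hji, mul_zero]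

variable [Finite G]

/-- At `K = H` every factor is `1 - 0`. At `K > H` an atom of `G/H` below `K/H` gives a factor `1 -
1`. At `K` not containing `H` all factors are `0 - 0`. -/
theorem map_unitImage_single (hs : Function.Injective s)
    (hΨ : ∀ A i, Ψ (c A) i = cosetValue (s i) A) {i : ι} (hi : s i < ⊤) :
    Ψ (unitImage c (s i)) = Pi.single i 1 := by
  have hcomap (L : Subgroup (G ⧸ s i)) (K : Subgroup G) (hK : s i ≤ K) :
      L.comap (QuotientGroup.mk' (s i)) ≤ K ↔ L ≤ K.map (QuotientGroup.mk' (s i)) := by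
    have hK' : (QuotientGroup.mk' (s i)).ker ≤ K := by rwa [QuotientGroup.ker_mk']
    conv_lhs => rw [← Subgroup.comap_map_eq_self hK']
    exact Subgroup.comap_le_comap_of_surjective (QuotientGroup.mk'_surjective _)
  have hle (L : Subgroup (G ⧸ s i)) : s i ≤ L.comap (QuotientGroup.mk' (s i)) := by
    simpa using Subgroup.ker_le_comap (f := QuotientGroup.mk' (s i)) L
  rw [unitImage, map_prod]
  ext1 j
  rw [Finset.prod_apply]
  simp only [map_sub, Pi.sub_apply, hΨ]
  rcases eq_or_ne j i with rfl | hji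
  · rw [Pi.single_eq_same]
    refine Finset.prod_eq_one fun L hL => ?_
    rw [cosetValue_coe_of_le le_rfl, cosetValue_coe_of_not_le, sub_zero]
    rw [hcomap L _ le_rfl]
    intro h
    rw [QuotientGroup.map_mk'_self] at h
    exact ((Set.Finite.mem_toFinset _).mp hL).1 (le_bot_iff.mp h)
  · rw [Pi.single_eq_of_ne hji]
    by_cases hij : s i ≤ s j
    · have hne : (s j).map (QuotientGroup.mk' (s i)) ≠ ⊥ := by
        intro h
        rw [Subgroup.map_eq_bot_iff, QuotientGroup.ker_mk'] at h
        exact hji (hs (h.antisymm hij))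
      obtain ⟨L, hL, hLj⟩ := (eq_bot_or_exists_atom_le _).resolve_left hne
      refine Finset.prod_eq_zero ((Set.Finite.mem_toFinset _).mpr hL) ?_
      rw [cosetValue_coe_of_le hij, cosetValue_coe_of_le ((hcomap L _ hij).mpr hLj), sub_self]
    -- Properness of `H` ensures that `G/H` has an atom, so the product is not empty and does
    -- contain a zero factor.
    · have hne : (⊤ : Subgroup (G ⧸ s i)) ≠ ⊥ := by
        intro h
        have := congrArg (Subgroup.comap (QuotientGroup.mk' (s i))) h
        rw [Subgroup.comap_top, MonoidHom.comap_bot, QuotientGroup.ker_mk'] at this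
        exact hi.ne this.symm
      obtain ⟨L, hL, -⟩ := (eq_bot_or_exists_atom_le _).resolve_left hne
      refine Finset.prod_eq_zero ((Set.Finite.mem_toFinset _).mpr hL) ?_
      rw [cosetValue_coe_of_not_le hij,
        cosetValue_coe_of_not_le fun h => hij ((hle L).trans h), sub_self]

variable [Finite ι]

theorem surjective_of_map_eq_cosetValue (hs : Function.Injective s)
    (hΨ : ∀ A i, Ψ (c A) i = cosetValue (s i) A) : Function.Surjective Ψ := by
  have := Fintype.ofFinite ι
  have hsingle (i : ι) : ∃ r, Ψ r = Pi.single i 1 := by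
    rcases lt_or_eq_of_le (le_top : s i ≤ ⊤) with hi | hi
    · exact ⟨_, map_unitImage_single hs hΨ hi⟩
    · exact ⟨_, map_univ_single hs hΨ hi⟩
  let b := Pi.basis fun i => MonoidAlgebra.basis (G ⧸ s i) ℚ
  have hb : ⊤ ≤ LinearMap.range Ψ.toLinearMap := by
    rw [← b.span_eq, Submodule.span_le]
    rintro _ ⟨⟨i, q⟩, rfl⟩
    obtain ⟨g, rfl⟩ := QuotientGroup.mk_surjective q
    obtain ⟨r, hr⟩ := hsingle i
    refine ⟨c {g} * r, ?_⟩
    simp only [AlgHom.toLinearMap_apply, map_mul, hr, map_singleton_mul_single hΨ, b,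
      Pi.basis_apply, MonoidAlgebra.basis_apply]
  exact LinearMap.range_eq_top.mp (top_le_iff.mp hb)

theorem ker_eq_cosetIdeal (hs : Function.Injective s)
    (hspan : Submodule.span ℚ (Set.range c) = ⊤) (hempty : c ∅ = 0)
    (hzero : ∀ H : Subgroup G, H ∉ Set.range s → ∀ g : G, c (g • (H : Set G)) = 0)
    (hΨ : ∀ A i, Ψ (c A) i = cosetValue (s i) A) :
    RingHom.ker Ψ = cosetIdeal c := by
  refine le_antisymm (fun x hx => ?_) (cosetIdeal_le_ker hΨ)
  have := Fintype.ofFinite ι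
  have := fun i => Fintype.ofFinite (G ⧸ s i)
  -- `V` is free on all cosets of the subgroups `s i`, so it has the dimension of the target of `Ψ`.
  let V := (Σ i, G ⧸ s i) →₀ ℚ
  let F : V →ₗ[ℚ] R :=
    Finsupp.linearCombination ℚ fun p : Σ i, G ⧸ s i => c (p.2.out • (s p.1 : Set G))
  have hF (i : ι) (g : G) : F (Finsupp.single ⟨i, g⟩ 1) = c (g • (s i : Set G)) := by
    rw [Finsupp.linearCombination_single, one_smul]
    congr 1
    dsimp only
    rw [leftCoset_eq_iff, ← QuotientGroup.eq, QuotientGroup.out_eq']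
  have hdecomp (x : R) : ∃ v, x - F v ∈ cosetIdeal c := by
    have hx : x ∈ Submodule.span ℚ (Set.range c) := hspan ▸ Submodule.mem_top
    induction hx using Submodule.span_induction with
    | mem x hx =>
      obtain ⟨A, rfl⟩ := hx
      rcases A.eq_empty_or_nonempty with rfl | hA
      · exact ⟨0, by simp [hempty]⟩
      obtain ⟨g, H, hAH, hsub⟩ := exists_isMinIdempotent hA
      have hmem : c (g • (H : Set G)) - c A ∈ cosetIdeal c :=
        Ideal.subset_span ⟨A, g, H, hA, hAH, hsub, rfl⟩
      rw [← neg_mem_iff, neg_sub] at hmem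
      by_cases hH : H ∈ Set.range s
      · obtain ⟨i, rfl⟩ := hH
        exact ⟨Finsupp.single ⟨i, g⟩ 1, by rwa [hF]⟩
      · exact ⟨0, by rwa [map_zero, ← hzero H hH g]⟩
    | zero => exact ⟨0, by simp⟩
    | add x y _ _ hx hy =>
      obtain ⟨v, hv⟩ := hx
      obtain ⟨w, hw⟩ := hy
      exact ⟨v + w, by rw [map_add, add_sub_add_comm]; exact add_mem hv hw⟩
    | smul a x _ hx =>
      obtain ⟨v, hv⟩ := hx
      refine ⟨a • v, ?_⟩
      rw [map_smul, ← smul_sub, Algebra.smul_def]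
      exact Ideal.mul_mem_left _ _ hv
  have hker {x : R} (hx : x ∈ cosetIdeal c) : Ψ x = 0 := cosetIdeal_le_ker hΨ hx
  -- `E` is onto because `Ψ` is onto and `F` is onto modulo `I ⊆ ker Ψ`; equality of dimensions
  -- makes it injective.
  let E := Ψ.toLinearMap ∘ₗ F
  have hsurj : Function.Surjective E := by
    intro t
    obtain ⟨x, rfl⟩ := surjective_of_map_eq_cosetValue hs hΨ t
    obtain ⟨v, hv⟩ := hdecomp x
    have := hker hv
    rw [map_sub, sub_eq_zero] at this
    exact ⟨v, this.symm⟩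
  let b := Pi.basis fun i => MonoidAlgebra.basis (G ⧸ s i) ℚ
  have hfin : Module.Finite ℚ ((i : ι) → MonoidAlgebra ℚ (G ⧸ s i)) := .of_basis b
  have hrank : Module.finrank ℚ V = Module.finrank ℚ ((i : ι) → MonoidAlgebra ℚ (G ⧸ s i)) := by
    rw [Module.finrank_eq_card_basis b, Module.finrank_finsupp_self]
  have hinj := (LinearMap.injective_iff_surjective_of_finrank_eq_finrank hrank).mpr hsurj
  obtain ⟨v, hv⟩ := hdecomp x
  have h0 : E v = 0 := by
    have := hker hv
    rw [map_sub, RingHom.mem_ker.mp hx, zero_sub, neg_eq_zero] at this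
    exact this
  obtain rfl : v = 0 := hinj (h0.trans (map_zero E).symm)
  simpa using hv

/-- A surjection carries the radical into the radical of the target, which vanishes by Maschke's
theorem; conversely the kernel is generated by nilpotents. -/
theorem jacobson_eq_ker (hs : Function.Injective s)
    (hspan : Submodule.span ℚ (Set.range c) = ⊤) (hempty : c ∅ = 0)
    (hzero : ∀ H : Subgroup G, H ∉ Set.range s → ∀ g : G, c (g • (H : Set G)) = 0)
    (hΨ : ∀ A i, Ψ (c A) i = cosetValue (s i) A) :
    Ring.jacobson R = RingHom.ker Ψ := by
  refine le_antisymm ?_ ?_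
  · have hsurj : Function.Surjective Ψ.toRingHom := surjective_of_map_eq_cosetValue hs hΨ
    have : RingHomSurjective Ψ.toRingHom := ⟨hsurj⟩
    have h := Ring.le_comap_jacobson Ψ.toRingHom
    rw [IsSemisimpleRing.jacobson_eq_bot ((i : ι) → MonoidAlgebra ℚ (G ⧸ s i))] at h
    exact h
  · rw [ker_eq_cosetIdeal hs hspan hempty hzero hΨ]
    exact cosetIdeal_le_jacobson c

/-- If the images `c A` of the subsets span the `ℚ`-algebra `R`, and if `R` maps to the product of
the group algebras `ℚ(G/H)` by sending `c A` to the basis element of the coset containing `A`, then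
the radical of `R` is the coset ideal, with that product as quotient. -/
theorem exists_ringEquiv_quotient_jacobson (hs : Function.Injective s)
    (hspan : Submodule.span ℚ (Set.range c) = ⊤) (hempty : c ∅ = 0)
    (hzero : ∀ H : Subgroup G, H ∉ Set.range s → ∀ g : G, c (g • (H : Set G)) = 0)
    (hΨ : ∀ A i, Ψ (c A) i = cosetValue (s i) A) :
    Ring.jacobson R = cosetIdeal c ∧
      ∃ Φ : ((i : ι) → MonoidAlgebra ℚ (G ⧸ s i)) ≃+* R ⧸ Ring.jacobson R,
        (∀ i, s i < ⊤ → Φ (Pi.single i 1) = Ideal.Quotient.mk _ (unitImage c (s i))) ∧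
        (∀ i, s i = ⊤ → Φ (Pi.single i 1) = Ideal.Quotient.mk _ (c Set.univ)) ∧
        ∀ (i : ι) (g : G), Φ (Pi.single i (MonoidAlgebra.single (g : G ⧸ s i) 1)) =
          Ideal.Quotient.mk _ (c {g}) * Φ (Pi.single i 1) := by
  have hJ := jacobson_eq_ker hs hspan hempty hzero hΨ
  have hsurj : Function.Surjective Ψ.toRingHom := surjective_of_map_eq_cosetValue hs hΨ
  let Φ := ((Ideal.quotEquivOfEq hJ).trans (RingHom.quotientKerEquivOfSurjective hsurj)).symm
  have hΦ (r : R) : Φ (Ψ r) = Ideal.Quotient.mk _ r := by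
    rw [RingEquiv.symm_apply_eq]
    rfl
  refine ⟨hJ.trans (ker_eq_cosetIdeal hs hspan hempty hzero hΨ), Φ, fun i hi => ?_,
    fun i hi => ?_, fun i g => ?_⟩
  · rw [← map_unitImage_single hs hΨ hi, hΦ]
  · rw [← map_univ_single hs hΨ hi, hΦ]
  · rw [← map_singleton_mul_single hΨ, map_mul, hΦ]

/-- The variant of `exists_ringEquiv_quotient_jacobson` for the quotient of `R` by the ideal
generated by `c G`, with the product over the proper subgroups of `G`. -/
theorem exists_ringEquiv_contracted [DecidableEq {H : Subgroup G // H < ⊤}]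
    {Ψ : R →ₐ[ℚ] ((H : {H : Subgroup G // H < ⊤}) → MonoidAlgebra ℚ (G ⧸ H.1))}
    (hspan : Submodule.span ℚ (Set.range c) = ⊤) (hempty : c ∅ = 0)
    (hΨ : ∀ A H, Ψ (c A) H = cosetValue H.1 A) {c' : Set G → R ⧸ Ideal.span {c Set.univ}}
    (hc' : ∀ A, c' A = Ideal.Quotient.mk _ (c A)) :
    Ring.jacobson (R ⧸ Ideal.span {c Set.univ}) = cosetIdeal c' ∧
      ∃ Φ : ((H : {H : Subgroup G // H < ⊤}) → MonoidAlgebra ℚ (G ⧸ H.1)) ≃+*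
          (R ⧸ Ideal.span {c Set.univ}) ⧸ Ring.jacobson (R ⧸ Ideal.span {c Set.univ}),
        (∀ H, Φ (Pi.single H 1) = Ideal.Quotient.mk _ (unitImage c' H.1)) ∧
        ∀ (H : {H : Subgroup G // H < ⊤}) (g : G),
          Φ (Pi.single H (MonoidAlgebra.single (g : G ⧸ H.1) 1)) =
            Ideal.Quotient.mk _ (c' {g}) * Φ (Pi.single H 1) := by
  let I := Ideal.span {c Set.univ}
  let q := Ideal.Quotient.mkₐ ℚ I
  -- No coset of a proper subgroup contains all of `G`, so `Ψ` factors through the contracted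
  -- algebra.
  have hker : ∀ x ∈ I, Ψ x = 0 := by
    have : I ≤ RingHom.ker Ψ := by
      rw [Ideal.span_singleton_le_iff_mem, RingHom.mem_ker]
      ext1 H
      rw [hΨ]
      exact cosetValue_coe_of_not_le (H := ⊤) H.2.not_ge
    exact fun x hx => RingHom.mem_ker.mp (this hx)
  obtain rfl : c' = (q : R →* R ⧸ I).comp c := funext hc'
  have hzero (H : Subgroup G) (hH : H ∉ Set.range (Subtype.val : {H : Subgroup G // H < ⊤} → _))
      (g : G) : (q : R →* R ⧸ I).comp c (g • (H : Set G)) = 0 := by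
    obtain rfl : H = ⊤ := by
      by_contra h
      exact hH ⟨⟨H, lt_top_iff_ne_top.mpr h⟩, rfl⟩
    rw [Subgroup.coe_top, Set.smul_set_univ]
    exact Ideal.Quotient.eq_zero_iff_mem.mpr (Ideal.mem_span_singleton_self _)
  obtain ⟨hJ, Φ, h1, -, h3⟩ := exists_ringEquiv_quotient_jacobson
    (s := fun H : {H : Subgroup G // H < ⊤} => H.1) (c := (q : R →* R ⧸ I).comp c)
    (Ψ := Ideal.Quotient.liftₐ I Ψ hker) Subtype.val_injective
    (span_range_comp_eq_top (f := q) hspan (Ideal.Quotient.mkₐ_surjective ℚ I))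
    ((congrArg q hempty).trans (map_zero q)) hzero hΨ
  exact ⟨hJ, Φ, fun H => h1 H H.2, h3⟩

end Structure

/-- The function assigning to a subset of `G` the family of basis elements of `ℚ(G/H)` belonging to
the cosets that contain it. -/
def cosetValueHom {G ι : Type*} [CommGroup G] (s : ι → Subgroup G) :
    Set G →* ((i : ι) → MonoidAlgebra ℚ (G ⧸ s i)) where
  toFun A i := cosetValue (s i) A
  map_one' := funext fun i => cosetValue_singleton (s i) 1
  map_mul' A B := funext fun i => cosetValue_mul (s i) A B

theorem cosetValueHom_empty {G ι : Type*} [CommGroup G] (s : ι → Subgroup G) : cosetValueHom s ∅ = 0 :=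
  funext fun i => cosetValue_empty (s i)

/-! ### Homomorphisms from `ℚ(G̃)` given by multiplicative functions on subsets. -/

section RatAlg

variable {G : Type*} [CommGroup G] [Finite G] (φ : G ≃* (G →* ℂˣ))

/-- The convention `dim ∅ = 1` lets one formula cover empty sets too, so `χ` is multiplicative on
all subsets modulo `χ_∅`. -/
theorem chi_mul_chi_eq (A B : Set G) :
    chi φ A * chi φ B = chi φ (A * B) + (dim A * dim B - dim (A * B)) • chi φ ∅ := by
  refine (mulLin_single φ A B 1 1).trans ?_
  rw [one_mul, one_smul]
  congr 1
  refine Eq.trans ?_ (Finsupp.smul_single _ _ _).symm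
  simp

/-- The ring homomorphism from `R(G̃)` given by a multiplicative function on the subsets of `G` that
vanishes on the empty set. -/
def charRingLift {T : Type*} [CommRing T] (f : Set G →* T) (hf : f ∅ = 0) : CharRing φ →+* T :=
  let F : (Set G →₀ ℤ) →+ T := Finsupp.liftAddHom fun A => (zmultiplesHom T) (f A)
  have hF (A : Set G) (n : ℤ) : F (Finsupp.single A n) = n • f A := by simp [F]
  have hmul (x y : Set G →₀ ℤ) : F (mulLin φ x y) = F x * F y := by
    induction x using Finsupp.induction_linear with
    | zero => simp
    | add x₁ x₂ h₁ h₂ => simp only [map_add, LinearMap.add_apply, h₁, h₂, add_mul]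
    | single A a =>
      induction y using Finsupp.induction_linear with
      | zero => simp
      | add y₁ y₂ h₁ h₂ => simp only [map_add, h₁, h₂, mul_add]
      | single B b =>
        -- The correction term is a multiple of `χ_∅`, which `f` kills.
        rw [mulLin_single, map_zsmul, map_add, hF, hF, hF, hF, hf, map_mul]
        simp only [zsmul_eq_mul]
        push_cast
        ring
  { toFun := F
    map_zero' := map_zero F
    map_add' := map_add F
    map_one' := (hF 1 1).trans (by simp)
    map_mul' := hmul }

theorem charRingLift_chi {T : Type*} [CommRing T] (f : Set G →* T) (hf : f ∅ = 0) (A : Set G) :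
    charRingLift φ f hf (chi φ A) = f A := by
  change Finsupp.liftAddHom (fun A => (zmultiplesHom T) (f A)) (Finsupp.single A 1) = f A
  simp

/-- The homomorphism from `R(G̃) / (χ_∅)` given by a multiplicative function on the subsets of `G`
that vanishes on the empty set. -/
def charRingQuotientLift {T : Type*} [CommRing T] (f : Set G →* T) (hf : f ∅ = 0) :
    CharRing φ ⧸ Ideal.span {chi φ ∅} →+* T :=
  Ideal.Quotient.lift (Ideal.span {chi φ ∅}) (charRingLift φ f hf) fun x hx => by
    have : Ideal.span {chi φ ∅} ≤ RingHom.ker (charRingLift φ f hf) := by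
      rw [Ideal.span_singleton_le_iff_mem, RingHom.mem_ker, charRingLift_chi, hf]
    exact RingHom.mem_ker.mp (this hx)

/-- The homomorphism from `ℚ(G̃)` given by a multiplicative function on the subsets of `G` that
vanishes on the empty set. -/
def ratAlgLift {T : Type*} [CommRing T] [Algebra ℚ T] (f : Set G →* T) (hf : f ∅ = 0) :
    RatAlg φ →ₐ[ℚ] T :=
  Algebra.TensorProduct.lift (Algebra.ofId ℚ T)
    { toRingHom := charRingQuotientLift φ f hf
      commutes' := fun n => RingHom.congr_fun (Subsingleton.elim
        ((charRingQuotientLift φ f hf).comp (algebraMap ℤ _)) (algebraMap ℤ T)) n }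
    fun _ _ => Commute.all _ _

theorem ratAlgLift_ratChi {T : Type*} [CommRing T] [Algebra ℚ T] (f : Set G →* T) (hf : f ∅ = 0)
    (A : Set G) : ratAlgLift φ f hf (ratChi φ A) = f A := by
  rw [ratAlgLift, ratChi, Algebra.TensorProduct.lift_tmul, map_one, one_mul]
  exact charRingLift_chi φ f hf A

theorem ratChi_empty : ratChi φ (∅ : Set G) = 0 := by
  rw [ratChi, Ideal.Quotient.eq_zero_iff_mem.mpr (Ideal.mem_span_singleton_self _),
    TensorProduct.tmul_zero]

/-- The function `A ↦ χ_A` from the monoid of subsets of `G` to `ℚ(G̃)`. -/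
def ratChiHom : Set G →* RatAlg φ where
  toFun := ratChi φ
  map_one' := rfl
  map_mul' A B := by
    have h : Ideal.Quotient.mk (Ideal.span {chi φ ∅}) (chi φ (A * B)) =
        Ideal.Quotient.mk _ (chi φ A) * Ideal.Quotient.mk _ (chi φ B) := by
      rw [← map_mul, chi_mul_chi_eq, map_add, map_zsmul,
        Ideal.Quotient.eq_zero_iff_mem.mpr (Ideal.mem_span_singleton_self (chi φ ∅)), smul_zero,
        add_zero]
    rw [ratChi, h, ratChi, ratChi, Algebra.TensorProduct.tmul_mul_tmul, one_mul]

theorem span_range_ratChi : Submodule.span ℚ (Set.range (ratChi φ)) = ⊤ := by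
  refine eq_top_iff.mpr fun x _ => ?_
  induction x using TensorProduct.induction_on with
  | zero => exact zero_mem _
  | add x y hx hy => exact add_mem (hx trivial) (hy trivial)
  | tmul a y =>
    obtain ⟨y, rfl⟩ := Ideal.Quotient.mk_surjective y
    rw [← mul_one a, ← smul_eq_mul, ← TensorProduct.smul_tmul']
    refine Submodule.smul_mem _ _ ?_
    let K : CharRing φ →+ RatAlg φ :=
      (Algebra.TensorProduct.includeRight (R := ℤ) (A := ℚ)).toRingHom.toAddMonoidHom.comp
        (Ideal.Quotient.mk (Ideal.span {chi φ ∅})).toAddMonoidHom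
    let K' : (Set G →₀ ℤ) →+ RatAlg φ := K
    have hK (y : Set G →₀ ℤ) : K' y ∈ Submodule.span ℚ (Set.range (ratChi φ)) := by
      induction y using Finsupp.induction_linear with
      | zero => rw [map_zero]; exact zero_mem _
      | add x y hx hy => rw [map_add]; exact add_mem hx hy
      | single A n =>
        rw [← mul_one n, ← smul_eq_mul, ← Finsupp.smul_single, map_zsmul]
        have hA : K' (Finsupp.single A 1) ∈ Submodule.span ℚ (Set.range (ratChi φ)) :=
          Submodule.subset_span ⟨A, rfl⟩
        exact zsmul_mem hA n
    exact hK y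

theorem coe_ratChiHom : ⇑(ratChiHom φ) = ratChi φ := rfl

/-- The homomorphism from `ℚ(G̃)` to the product of a family of group algebras `ℚ(G/H)`. -/
def ratAlgToPi {ι : Type*} (s : ι → Subgroup G) :
    RatAlg φ →ₐ[ℚ] ((i : ι) → MonoidAlgebra ℚ (G ⧸ s i)) :=
  ratAlgLift φ (cosetValueHom s) (cosetValueHom_empty s)

theorem ratAlgToPi_ratChi {ι : Type*} (s : ι → Subgroup G) (A : Set G) (i : ι) :
    ratAlgToPi φ s (ratChi φ A) i = cosetValue (s i) A := by
  rw [ratAlgToPi, ratAlgLift_ratChi]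
  rfl

end RatAlg

end GliderRing

end

/-! ### The theorem for the contracted and the full algebra. -/

open Classical in
theorem mainTheorem3 {G : Type*} [CommGroup G] [Finite G] (φ : G ≃* (G →* ℂˣ)) :
    -- the contracted algebra, with the sum over the proper subgroups
    (Ring.jacobson (GliderRing.ContrAlg φ) = GliderRing.cosetIdeal (GliderRing.contrChi φ) ∧
      ∃ Φ : ((H : {H : Subgroup G // H < ⊤}) → MonoidAlgebra ℚ (G ⧸ H.1)) ≃+*
          GliderRing.ContrAlg φ ⧸ Ring.jacobson (GliderRing.ContrAlg φ),
        (∀ H : {H : Subgroup G // H < ⊤}, Φ (Pi.single H 1) =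
          Ideal.Quotient.mk _ (GliderRing.unitImage (GliderRing.contrChi φ) H.1)) ∧
        ∀ (H : {H : Subgroup G // H < ⊤}) (g : G),
          Φ (Pi.single H (MonoidAlgebra.single (g : G ⧸ H.1) 1)) =
            Ideal.Quotient.mk _ (GliderRing.contrChi φ {g}) * Φ (Pi.single H 1)) ∧
    -- the algebra itself, with the sum over all subgroups
    (Ring.jacobson (GliderRing.RatAlg φ) = GliderRing.cosetIdeal (GliderRing.ratChi φ) ∧
      ∃ Φ : ((H : Subgroup G) → MonoidAlgebra ℚ (G ⧸ H)) ≃+*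
          GliderRing.RatAlg φ ⧸ Ring.jacobson (GliderRing.RatAlg φ),
        (∀ H : Subgroup G, H < ⊤ → Φ (Pi.single H 1) =
          Ideal.Quotient.mk _ (GliderRing.unitImage (GliderRing.ratChi φ) H)) ∧
        Φ (Pi.single ⊤ 1) = Ideal.Quotient.mk _ (GliderRing.ratChi φ Set.univ) ∧
        ∀ (H : Subgroup G) (g : G),
          Φ (Pi.single H (MonoidAlgebra.single (g : G ⧸ H) 1)) =
            Ideal.Quotient.mk _ (GliderRing.ratChi φ {g}) * Φ (Pi.single H 1)) := by
  constructor
  · exact GliderRing.exists_ringEquiv_contracted (c := GliderRing.ratChiHom φ)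
      (Ψ := GliderRing.ratAlgToPi φ Subtype.val) (GliderRing.span_range_ratChi φ)
      (GliderRing.ratChi_empty φ) (GliderRing.ratAlgToPi_ratChi φ _)
      (c' := GliderRing.contrChi φ) fun _ => rfl
  · have h := GliderRing.exists_ringEquiv_quotient_jacobson
      (c := GliderRing.ratChiHom φ) (s := fun H : Subgroup G => H)
      (Ψ := GliderRing.ratAlgToPi φ fun H => H) Function.injective_id
      (GliderRing.span_range_ratChi φ) (GliderRing.ratChi_empty φ)
      (fun H hH => absurd ⟨H, rfl⟩ hH) (GliderRing.ratAlgToPi_ratChi φ _)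
    rw [GliderRing.coe_ratChiHom] at h
    obtain ⟨hJ, Φ, h1, h2, h3⟩ := h
    exact ⟨hJ, Φ, h1, h2 ⊤ rfl, h3⟩
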